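/- For integers $a \le b$ write $[a,b]=\{a,a+1,\dots,b\}$ (empty if $a>b$) and $[n]=[1,n]$, and let $\binom{[n]}{r}$ be the family of all $r$-element subsets of $[n]$. A family $\mathcal{A}\subseteq\binom{[n]}{r}$ is intersecting if no two members of $\mathcal{A}$ are disjoint. It is left-compressed if, for all $i>j$ in $[n]$ and every $A\in\mathcal{A}$ with $i\in A$ and $j\notin A$, the set $(A\setminus\{i\})\cup\{j\}$ also belongs to $\mathcal{A}$ (that is, $\mathcal{A}$ is fixed by every $ij$-shift with $i>j$). An LCIF is a left-compressed intersecting family $\mathcal{A}\subseteq\binom{[n]}{r}$, and an MLCIF is an LCIF that is maximal under inclusion among all LCIFs. For $X\subseteq[n]$ let $\mathrm{hit}_X(\mathcal{A})=|\{A\in\mathcal{A}: A\cap X\neq\emptyset\}|$. An LCIF (respectively, an MLCIF) is optimal for $X$ if it maximises $\mathrm{hit}_X$ among all LCIFs (respectively, among all MLCIFs) in $\binom{[n]}{r}$. Let $\mathcal{S}=\{A\in\binom{[n]}{r}: 1\in A\}$ be the star at $1$, and for $t\in[n]$ let $$\mathcal{AHM}_t=\{A\in\mathcal{S}: A\cap[2,t]\neq\emptyset\}\cup\left\{A\in\tbinom{[n]}{r}: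 [2,t]\subseteq A\right\}.$$ Corollary 3.3. For every integer $r\ge 3$ there is an integer $N$ such that the following holds for every $n\ge N$ and every non-empty $X\subseteq[2,n]$, where $m=\max X$. (i) If $\mathcal{S}$ is not an optimal MLCIF for $X$, then the optimal LCIFs for $X$ are precisely the optimal MLCIFs for $X$. (ii) If $\mathcal{S}$ is an optimal MLCIF for $X$, then the optimal LCIFs for $X$ are precisely the LCIFs $\mathcal{A}$ with $\mathcal{AHM}_m\subseteq\mathcal{A}\subseteq\mathcal{S}$. -/

import Mathlib

open Finset

namespace LCIF

/-- The family of all `r`-element subsets of `[n] = {1, …, n}`. -/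
def layer (n r : ℕ) : Finset (Finset ℕ) := (Icc 1 n).powersetCard r

/-- A family of subsets of `[n]` is left-compressed if for all `i > j` in `[n]` it is fixed by the
`ij`-shift, which replaces each member `A` with `i ∈ A`, `j ∉ A` by `(A \ {i}) ∪ {j}` unless the
latter is already a member. This shift is the `UV`-compression along `{j}` and `{i}`. -/
def IsLeftCompressed (n : ℕ) (𝒜 : Finset (Finset ℕ)) : Prop :=
  ∀ i ∈ Icc 1 n, ∀ j ∈ Icc 1 n, j < i → UV.IsCompressed ({j} : Finset ℕ) {i} 𝒜

/-- `𝒜` is a left-compressed intersecting family (LCIF) of `r`-element subsets of `[n]`. -/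
structure IsLCIF (n r : ℕ) (𝒜 : Finset (Finset ℕ)) : Prop where
  subset_layer : 𝒜 ⊆ layer n r
  leftCompressed : IsLeftCompressed n 𝒜
  intersecting : (𝒜 : Set (Finset ℕ)).Intersecting

/-- `𝒜` is a maximal (with respect to inclusion) left-compressed intersecting family (MLCIF). -/
def IsMLCIF (n r : ℕ) (𝒜 : Finset (Finset ℕ)) : Prop := Maximal (IsLCIF n r) 𝒜

/-- The number of members of `𝒜` that meet `X`. -/
def hit (X : Finset ℕ) (𝒜 : Finset (Finset ℕ)) : ℕ := #{A ∈ 𝒜 | (A ∩ X).Nonempty}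

/-- `𝒜` is an LCIF that has maximum hitting with `X` among all LCIFs. -/
def IsOptimalLCIF (n r : ℕ) (X : Finset ℕ) (𝒜 : Finset (Finset ℕ)) : Prop :=
  IsLCIF n r 𝒜 ∧ ∀ ℱ, IsLCIF n r ℱ → hit X ℱ ≤ hit X 𝒜

/-- `𝒜` is an MLCIF that has maximum hitting with `X` among all MLCIFs. -/
def IsOptimalMLCIF (n r : ℕ) (X : Finset ℕ) (𝒜 : Finset (Finset ℕ)) : Prop :=
  IsMLCIF n r 𝒜 ∧ ∀ ℱ, IsMLCIF n r ℱ → hit X ℱ ≤ hit X 𝒜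

/-- The star at `1`: all `r`-element subsets of `[n]` that contain `1`. -/
def star (n r : ℕ) : Finset (Finset ℕ) := {A ∈ layer n r | 1 ∈ A}

/-- The `t`-adjusted Hilton–Milner family. -/
def AHM (n r t : ℕ) : Finset (Finset ℕ) :=
  {A ∈ star n r | (A ∩ Icc 2 t).Nonempty} ∪ {A ∈ layer n r | Icc 2 t ⊆ A}

end LCIF

namespace LCIF

/-! Any two members of an LCIF already meet inside `[2r]`. So if a family is not contained in the
star, every trace on `[2r]` has at least two elements. For bounded `|X|`, its hit count is then at
most `p * C(n-2, r-2)` plus a multiple of `C(n-3, r-3)`, where `p` is the number of two-element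
traces meeting `X`. The star hits `|X| * C(n-2, r-2)` sets up to an error of the same kind. Hence
for large `n` an optimal family outside the star has `p ≥ |X|`; a large `X` is handled through a
subset of bounded size.

If `{2,3}` is a trace, the family lies in `AHM n r 3`, and `p ≥ |X|` leaves only a few shapes of
`X`, for which optimality forces the whole of `AHM n r 3`. Otherwise every pair trace meeting `X`
contains 1, so `{1,m}` must be a trace. Then all members meeting `X` lie in `AHM n r m`, and
optimality with compression gives equality if `m ≥ 3`; if `m = 2`, `AHM n r 3` does better. Either
way the family is maximal and strictly beats the star (`IsOptimalLCIF.isMLCIF_of_not_subset_star`).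

When the star is optimal, an optimal family therefore lies in the star and contains all star members
meeting `X`; compression turns this into containing `AHM n r m`. -/

variable {n r : ℕ} {𝒜 ℬ : Finset (Finset ℕ)} {X F : Finset ℕ}

/-! ### Layers and shifts -/

lemma mem_layer : F ∈ layer n r ↔ F ⊆ Icc 1 n ∧ #F = r := mem_powersetCard

lemma mem_star : F ∈ star n r ↔ F ∈ layer n r ∧ 1 ∈ F := by simp [star]

lemma mem_AHM {t : ℕ} : F ∈ AHM n r t ↔
    F ∈ layer n r ∧ ((1 ∈ F ∧ ∃ x ∈ F, 2 ≤ x ∧ x ≤ t) ∨ Icc 2 t ⊆ F) := by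
  simp only [AHM, mem_union, mem_filter, mem_star, Finset.Nonempty, mem_inter, mem_Icc, and_assoc,
    ← and_or_left]

lemma exists_mem_layer {P Q : Finset ℕ} (hP : P ⊆ Icc 1 n) (hPr : #P ≤ r)
    (hPQ : Disjoint P Q) (hn : r + #Q ≤ n) :
    ∃ W ∈ layer n r, P ⊆ W ∧ Disjoint W Q := by
  have h1 : P ⊆ Icc 1 n \ Q := subset_sdiff.2 ⟨hP, hPQ⟩
  have h2 : r ≤ #(Icc 1 n \ Q) := by
    have := le_card_sdiff Q (Icc 1 n)
    simp at this; omega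
  obtain ⟨W, hPW, hW, hc⟩ := exists_subsuperset_card_eq h1 hPr h2
  rw [subset_sdiff] at hW
  exact ⟨W, mem_layer.2 ⟨hW.1, hc⟩, hPW, hW.2⟩

lemma shift_mem_layer {i j : ℕ} (hF : F ∈ layer n r) (hj : j ∈ Icc 1 n) (hi : i ∈ F)
    (hjF : j ∉ F) : insert j (F.erase i) ∈ layer n r := by
  rw [mem_layer] at hF ⊢
  refine ⟨insert_subset hj ((erase_subset _ _).trans hF.1), ?_⟩
  rw [card_insert_of_notMem (fun h => hjF (mem_of_mem_erase h)), card_erase_of_mem hi]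
  have := card_pos.2 ⟨i, hi⟩
  omega

lemma compress_singleton (i j : ℕ) (F : Finset ℕ) : UV.compress ({j} : Finset ℕ) {i} F =
    if j ∉ F ∧ i ∈ F then (insert j F).erase i else F := by
  unfold UV.compress
  simp only [disjoint_singleton_left, singleton_subset_iff]
  split_ifs
  · ext; simp; tauto
  · rfl

lemma isLeftCompressed_of_shift
    (h : ∀ F ∈ 𝒜, ∀ i j, 1 ≤ j → j < i → i ≤ n → i ∈ F → j ∉ F → insert j (F.erase i) ∈ 𝒜) :
    IsLeftCompressed n 𝒜 := by
  intro i hi j hj hji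
  have key : ∀ F ∈ 𝒜, UV.compress ({j} : Finset ℕ) {i} F ∈ 𝒜 := by
    intro F hF
    rw [compress_singleton]
    split_ifs with hc
    · rw [erase_insert_of_ne hji.ne]
      exact h F hF i j (mem_Icc.1 hj).1 hji (mem_Icc.1 hi).2 hc.2 hc.1
    · exact hF
  unfold UV.IsCompressed
  ext F
  rw [UV.mem_compression]
  constructor
  · rintro (⟨h1, -⟩ | ⟨h1, G, hG, rfl⟩)
    · exact h1
    · exact key G hG
  · exact fun hF => Or.inl ⟨hF, key F hF⟩

lemma IsLCIF.shift (h : IsLCIF n r 𝒜) (hF : F ∈ 𝒜) {i j : ℕ} (hj : 1 ≤ j) (hji : j < i)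
    (hi : i ∈ F) (hjF : j ∉ F) : insert j (F.erase i) ∈ 𝒜 := by
  have hin := (mem_layer.1 (h.subset_layer hF)).1 hi
  have hc := h.leftCompressed i hin j (by simp at hin ⊢; omega) hji
  have := UV.compress_mem_compression (u := ({j} : Finset ℕ)) (v := {i}) hF
  rwa [hc.eq, compress_singleton, if_pos ⟨hjF, hi⟩, erase_insert_of_ne hji.ne] at this

/-! ### Traces on an initial segment -/

/-- Elements of `F` outside `W` lie beyond `k`, so each can be shifted down onto a missing element
of `W`. -/
lemma IsLCIF.mem_of_trace_subset (h : IsLCIF n r 𝒜) {k : ℕ} (W : Finset ℕ)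
    (hW : W ⊆ Icc 1 k) (hWr : #W = r) (hF : F ∈ 𝒜) (hFW : F ∩ Icc 1 k ⊆ W) : W ∈ 𝒜 := by
  induction hd : #(W \ F) generalizing F with
  | zero =>
    have : W ⊆ F := by rwa [card_eq_zero, sdiff_eq_empty_iff_subset] at hd
    rwa [eq_of_subset_of_card_le this (by rw [hWr, (mem_layer.1 (h.subset_layer hF)).2])]
  | succ d ih =>
    have hcF := (mem_layer.1 (h.subset_layer hF)).2
    obtain ⟨j, hj⟩ : (W \ F).Nonempty := card_pos.1 (by omega)
    obtain ⟨i, hi⟩ : (F \ W).Nonempty := by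
      apply card_pos.1
      rw [← card_sdiff_comm (hWr.trans hcF.symm)]; omega
    rw [mem_sdiff] at hi hj
    have hjk := mem_Icc.1 (hW hj.1)
    have hik : k < i := by
      by_contra hik
      refine hi.2 (hFW (mem_inter.2 ⟨hi.1, mem_Icc.2 ⟨?_, by omega⟩⟩))
      exact (mem_Icc.1 ((mem_layer.1 (h.subset_layer hF)).1 hi.1)).1
    refine ih (h.shift hF hjk.1 (hjk.2.trans_lt hik) hi.1 hj.2) ?_ ?_
    · intro x hx
      simp only [mem_inter, mem_insert, mem_erase] at hx
      rcases hx.1 with rfl | hx'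
      · exact hj.1
      · exact hFW (mem_inter.2 ⟨hx'.2, hx.2⟩)
    · have : W \ insert j (F.erase i) = (W \ F).erase j := by
        ext x
        simp only [mem_sdiff, mem_insert, mem_erase]
        constructor
        · rintro ⟨h1, h2⟩
          refine ⟨fun hh => h2 (Or.inl hh), h1, fun hh => h2 (Or.inr ⟨?_, hh⟩)⟩
          rintro rfl; exact hi.2 h1
        · tauto
      rw [this, card_erase_of_mem (mem_sdiff.2 hj)]; omega

/-- Members of an LCIF already intersect inside `[2r]`. -/
lemma IsLCIF.exists_mem_inter (h : IsLCIF n r 𝒜) {G : Finset ℕ} (hF : F ∈ 𝒜) (hG : G ∈ 𝒜) :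
    ∃ x ∈ F, x ∈ G ∧ x ∈ Icc 1 (2 * r) := by
  by_contra! hc
  have hcF := (mem_layer.1 (h.subset_layer hF)).2
  have hcG := (mem_layer.1 (h.subset_layer hG)).2
  -- `W` and its complement in `[2r]` both have size `r` and contain the traces of `F` and `G`, so
  -- both are members, yet they are disjoint.
  obtain ⟨W, hW, hFW, hWG⟩ := exists_mem_layer (n := 2 * r) (r := r)
    (P := F ∩ Icc 1 (2 * r)) (Q := G ∩ Icc 1 (2 * r)) inter_subset_right
    ((card_le_card inter_subset_left).trans hcF.le)
    (by
      rw [disjoint_left]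
      intro x hx hx'
      rw [mem_inter] at hx hx'
      exact hc x hx.1 hx'.1 hx.2)
    (by have := card_le_card (inter_subset_left : G ∩ Icc 1 (2 * r) ⊆ G); omega)
  rw [mem_layer] at hW
  have h1 := h.mem_of_trace_subset W hW.1 hW.2 hF hFW
  have h2 := h.mem_of_trace_subset (Icc 1 (2 * r) \ W) sdiff_subset
    (by rw [card_sdiff_of_subset hW.1, hW.2]; simp; omega) hG (by
      rw [subset_sdiff]
      exact ⟨inter_subset_right, hWG.symm⟩)
  exact h.intersecting h1 h2 disjoint_sdiff

lemma IsLCIF.trace_shift (h : IsLCIF n r 𝒜) (hF : F ∈ 𝒜) {P : Finset ℕ} {i j k : ℕ}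
    (hFP : F ∩ Icc 1 k = P) (hj : 1 ≤ j) (hji : j < i) (hi : i ∈ P) (hjP : j ∉ P) :
    ∃ F' ∈ 𝒜, F' ∩ Icc 1 k = insert j (P.erase i) := by
  subst hFP
  rw [mem_inter, mem_Icc] at hi
  have hjk : j ∈ Icc 1 k := mem_Icc.2 ⟨hj, by omega⟩
  refine ⟨_, h.shift hF hj hji hi.1 fun hjF => hjP (mem_inter.2 ⟨hjF, hjk⟩), ?_⟩
  ext x
  simp only [mem_inter, mem_insert, mem_erase]
  constructor
  · tauto
  · rintro (rfl | hx)
    · tauto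
    · tauto

/-- A trace `{j}` would put `j` in every member. If `j ≠ 1`, shifting `j` to 1 gives a member
without `j`; if `j = 1`, the family is inside the star. -/
lemma IsLCIF.two_le_card_trace (h : IsLCIF n r 𝒜) (hS : ¬ 𝒜 ⊆ star n r) (hF : F ∈ 𝒜) :
    2 ≤ #(F ∩ Icc 1 (2 * r)) := by
  by_contra hlt
  obtain ⟨j, hjF, -, hj⟩ := h.exists_mem_inter hF hF
  have htr : F ∩ Icc 1 (2 * r) = {j} := by
    symm
    apply eq_of_subset_of_card_le
    · simpa using ⟨hjF, mem_Icc.1 hj⟩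
    · simp; omega
  have hall : ∀ {F j}, F ∈ 𝒜 → F ∩ Icc 1 (2 * r) = {j} → ∀ G ∈ 𝒜, j ∈ G := by
    intro F j hF htr G hG
    obtain ⟨x, hx, hxG, hx2⟩ := h.exists_mem_inter hF hG
    have : x ∈ F ∩ Icc 1 (2 * r) := mem_inter.2 ⟨hx, hx2⟩
    rw [htr, mem_singleton] at this
    exact this ▸ hxG
  have hj1 : j = 1 := by
    by_contra hne
    have h1j := (mem_Icc.1 hj).1
    obtain ⟨F', hF', htr'⟩ := h.trace_shift hF htr le_rfl (i := j) (by omega)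
      (mem_singleton_self j) (by simp; omega)
    have := hall hF htr F' hF'
    have : j ∈ F' ∩ Icc 1 (2 * r) := mem_inter.2 ⟨this, hj⟩
    rw [htr'] at this
    simp at this; omega
  subst hj1
  exact hS fun G hG => mem_star.2 ⟨h.subset_layer hG, hall hF htr G hG⟩

lemma IsLCIF.exists_trace_two_three (h : IsLCIF n r 𝒜) (hF : F ∈ 𝒜) {k : ℕ}
    (h1 : 1 ∉ F) (h2 : #(F ∩ Icc 1 k) = 2) : ∃ F' ∈ 𝒜, F' ∩ Icc 1 k = {2, 3} := by
  obtain ⟨i, j, hij, hP⟩ : ∃ i j, i < j ∧ F ∩ Icc 1 k = {i, j} := by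
    obtain ⟨i, j, hne, hP⟩ := card_eq_two.1 h2
    rcases lt_or_gt_of_ne hne with hlt | hlt
    · exact ⟨i, j, hlt, hP⟩
    · exact ⟨j, i, hlt, by rw [hP, pair_comm]⟩
  have hi : i ∈ F ∩ Icc 1 k := by simp [hP]
  have hi2 : 2 ≤ i := by
    rw [mem_inter, mem_Icc] at hi
    have : i ≠ 1 := by rintro rfl; exact h1 hi.1
    omega
  obtain ⟨F₁, hF₁, hP₁⟩ : ∃ F' ∈ 𝒜, F' ∩ Icc 1 k = {2, j} := by
    rcases hi2.eq_or_lt with rfl | hlt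
    · exact ⟨F, hF, hP⟩
    · obtain ⟨F', hF', hP'⟩ := h.trace_shift hF hP (by norm_num) hlt (by simp) (by simp; omega)
      refine ⟨F', hF', hP'.trans ?_⟩
      rw [erase_insert (by simp; omega)]
  rcases (show 3 ≤ j by omega).eq_or_lt with rfl | hlt
  · exact ⟨F₁, hF₁, hP₁⟩
  · obtain ⟨F', hF', hP'⟩ := h.trace_shift hF₁ hP₁ (by norm_num) hlt (by simp) (by simp; omega)
    refine ⟨F', hF', hP'.trans ?_⟩
    ext x; simp; omega

/-- Shifting also yields the traces `{1,3}` and `{1,2}`; a set meeting all three pairs contains two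
of 1, 2, 3. -/
lemma IsLCIF.subset_AHM_three (h : IsLCIF n r 𝒜) (hF : F ∈ 𝒜)
    (hP : F ∩ Icc 1 (2 * r) = {2, 3}) : 𝒜 ⊆ AHM n r 3 := by
  have key : ∀ {F i j}, F ∈ 𝒜 → F ∩ Icc 1 (2 * r) = {i, j} → ∀ G ∈ 𝒜, i ∈ G ∨ j ∈ G := by
    intro F i j hF htr G hG
    obtain ⟨x, hx, hxG, hx2⟩ := h.exists_mem_inter hF hG
    have : x ∈ F ∩ Icc 1 (2 * r) := mem_inter.2 ⟨hx, hx2⟩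
    rw [htr, mem_insert, mem_singleton] at this
    rcases this with rfl | rfl <;> tauto
  obtain ⟨F₁, hF₁, hP₁⟩ := h.trace_shift hF hP le_rfl (i := 2) (by norm_num) (by simp) (by simp)
  obtain ⟨F₂, hF₂, hP₂⟩ := h.trace_shift hF hP le_rfl (i := 3) (by norm_num) (by simp) (by simp)
  intro G hG
  have e1 := key hF hP G hG
  have e2 := key (i := 1) (j := 3) hF₁ (hP₁.trans (by decide)) G hG
  have e3 := key (i := 1) (j := 2) hF₂ (hP₂.trans (by decide)) G hG
  rw [mem_AHM]
  refine ⟨h.subset_layer hG, ?_⟩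
  have h23 : Icc 2 3 = ({2, 3} : Finset ℕ) := by decide
  rw [h23, insert_subset_iff, singleton_subset_iff]
  by_cases h1 : 1 ∈ G
  · left
    refine ⟨h1, ?_⟩
    rcases e1 with e | e
    · exact ⟨2, e, by norm_num⟩
    · exact ⟨3, e, by norm_num⟩
  · tauto

/-- The trace `{1,m}` shifts to `{1,j}` for each `j` in `[2,m]`, and a member without 1 can meet it
only in `j`. -/
lemma IsLCIF.Icc_subset (h : IsLCIF n r 𝒜) (hF : F ∈ 𝒜) {m : ℕ}
    (hP : F ∩ Icc 1 (2 * r) = {1, m}) {G : Finset ℕ} (hG : G ∈ 𝒜) (h1 : 1 ∉ G) :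
    Icc 2 m ⊆ G := by
  intro j hj
  rw [mem_Icc] at hj
  obtain ⟨F', hF', hP'⟩ : ∃ F' ∈ 𝒜, F' ∩ Icc 1 (2 * r) = {1, j} := by
    rcases hj.2.eq_or_lt with rfl | hlt
    · exact ⟨F, hF, hP⟩
    · obtain ⟨F', hF', hP'⟩ := h.trace_shift hF hP (by omega) hlt (by simp) (by simp; omega)
      refine ⟨F', hF', hP'.trans ?_⟩
      ext x; simp; omega
  obtain ⟨x, hx, hxG, hx2⟩ := h.exists_mem_inter hF' hG
  have : x ∈ F' ∩ Icc 1 (2 * r) := mem_inter.2 ⟨hx, hx2⟩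
  rw [hP', mem_insert, mem_singleton] at this
  rcases this with rfl | rfl
  · exact absurd hxG h1
  · exact hxG

/-! ### The star and the adjusted Hilton–Milner families -/

lemma isLCIF_star : IsLCIF n r (star n r) where
  subset_layer := filter_subset _ _
  leftCompressed := by
    apply isLeftCompressed_of_shift
    intro F hF i j hj hji hi hiF hjF
    rw [mem_star] at hF ⊢
    refine ⟨shift_mem_layer hF.1 (mem_Icc.2 ⟨hj, by omega⟩) hiF hjF, ?_⟩
    simp only [mem_insert, mem_erase]
    exact Or.inr ⟨by omega, hF.2⟩
  intersecting := by
    intro F hF G hG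
    rw [mem_coe, mem_star] at hF hG
    exact not_disjoint_iff.2 ⟨1, hF.2, hG.2⟩

lemma isLCIF_AHM {t : ℕ} (ht : 3 ≤ t) : IsLCIF n r (AHM n r t) where
  subset_layer := fun F hF => (mem_AHM.1 hF).1
  leftCompressed := by
    apply isLeftCompressed_of_shift
    intro F hF i j hj hji hi hiF hjF
    rw [mem_AHM] at hF ⊢
    refine ⟨shift_mem_layer hF.1 (mem_Icc.2 ⟨hj, by omega⟩) hiF hjF, ?_⟩
    simp only [mem_insert, mem_erase]
    rcases hF.2 with ⟨h1, x, hx, hx2, hxt⟩ | hsub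
    · left
      refine ⟨Or.inr ⟨by omega, h1⟩, ?_⟩
      have hj1 : j ≠ 1 := by rintro rfl; exact hjF h1
      by_cases hxi : x = i
      · exact ⟨j, Or.inl rfl, by omega, by omega⟩
      · exact ⟨x, Or.inr ⟨hxi, hx⟩, hx2, hxt⟩
    · have h2 : 2 ∈ F := hsub (mem_Icc.2 (by omega))
      have h3 : 3 ∈ F := hsub (mem_Icc.2 (by omega))
      by_cases hj1 : j = 1
      · left
        refine ⟨Or.inl hj1.symm, ?_⟩
        by_cases hi2 : i = 2
        · exact ⟨3, Or.inr ⟨by omega, h3⟩, by omega, by omega⟩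
        · exact ⟨2, Or.inr ⟨by omega, h2⟩, by omega, by omega⟩
      · right
        intro y hy
        simp only [mem_insert, mem_erase]
        have hyt := mem_Icc.1 hy
        refine Or.inr ⟨?_, hsub hy⟩
        rintro rfl
        exact hjF (hsub (mem_Icc.2 (by omega)))
  intersecting := by
    intro F hF G hG
    rw [mem_coe, mem_AHM] at hF hG
    rw [not_disjoint_iff]
    rcases hF.2 with ⟨h1, x, hx, hx2⟩ | hsub <;> rcases hG.2 with ⟨h1', x', hx', hx2'⟩ | hsub'
    · exact ⟨1, h1, h1'⟩
    · exact ⟨x, hx, hsub' (mem_Icc.2 hx2)⟩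
    · exact ⟨x', hsub (mem_Icc.2 hx2'), hx'⟩
    · exact ⟨2, hsub (mem_Icc.2 (by omega)), hsub' (mem_Icc.2 (by omega))⟩

/-- A set outside `AHM n r t` is disjoint from an `r`-set containing `[2,t]`, which exists as `t ≤ r
+ 1`, or from one containing some `{1,j}` with `j` in `[2,t]`. -/
lemma subset_AHM_of_intersecting {t : ℕ} (htr : t ≤ r + 1) (hr : 2 ≤ r)
    (hn : 2 * r + 1 ≤ n) (h : IsLCIF n r 𝒜) (hA : AHM n r t ⊆ 𝒜) : 𝒜 ⊆ AHM n r t := by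
  intro F hF
  have hFl := mem_layer.1 (h.subset_layer hF)
  rw [mem_AHM]
  refine ⟨h.subset_layer hF, ?_⟩
  by_cases h1 : 1 ∈ F
  · left
    refine ⟨h1, ?_⟩
    by_contra! hc
    obtain ⟨W, hW, hsub, hWF⟩ := exists_mem_layer (n := n) (r := r) (P := Icc 2 t) (Q := F)
      (Icc_subset_Icc (by norm_num) (by omega)) (by simp; omega)
      (by
        rw [disjoint_left]
        intro x hx hxF
        rw [mem_Icc] at hx
        have := hc x hxF hx.1
        omega) (by omega)
    exact h.intersecting (hA (mem_AHM.2 ⟨hW, Or.inr hsub⟩)) hF hWF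
  · right
    intro j hj
    by_contra hjF
    have hj' := mem_Icc.1 hj
    obtain ⟨W, hW, hsub, hWF⟩ := exists_mem_layer (n := n) (r := r) (P := {1, j}) (Q := F)
      (by
        rw [insert_subset_iff, singleton_subset_iff, mem_Icc, mem_Icc]
        omega) (card_le_two.trans hr)
      (by simp [h1, hjF]) (by omega)
    rw [insert_subset_iff, singleton_subset_iff] at hsub
    exact h.intersecting (hA (mem_AHM.2 ⟨hW, Or.inl ⟨hsub.1, j, hsub.2, hj'⟩⟩)) hF hWF

lemma isMLCIF_AHM {t : ℕ} (ht : 3 ≤ t) (htr : t ≤ r + 1) (hn : 2 * r + 1 ≤ n) :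
    IsMLCIF n r (AHM n r t) :=
  ⟨isLCIF_AHM ht, fun _ hB hAB =>
    subset_AHM_of_intersecting htr (by omega) hn hB hAB⟩

lemma isMLCIF_star (hr : 1 ≤ r) (hn : 2 * r ≤ n) : IsMLCIF n r (star n r) := by
  refine ⟨isLCIF_star, fun B hB hAB F hF => ?_⟩
  rw [mem_star]
  refine ⟨hB.subset_layer hF, ?_⟩
  by_contra h1
  have hFl := mem_layer.1 (hB.subset_layer hF)
  obtain ⟨W, hW, hsub, hWF⟩ := exists_mem_layer (n := n) (r := r) (P := {1}) (Q := F)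
    (by simp; omega) (by simpa) (by simpa) (by omega)
  exact hB.intersecting (hAB (mem_star.2 ⟨hW, hsub (by simp)⟩)) hF hWF

lemma IsLCIF.exists_isMLCIF (h : IsLCIF n r 𝒜) : ∃ ℬ, IsMLCIF n r ℬ ∧ 𝒜 ⊆ ℬ := by
  have hfin : {ℬ | IsLCIF n r ℬ}.Finite :=
    (layer n r).powerset.finite_toSet.subset fun ℬ hℬ => by
      simpa using hℬ.subset_layer
  obtain ⟨ℬ, hAB, hℬ⟩ := hfin.exists_le_maximal h
  exact ⟨ℬ, hℬ, hAB⟩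

/-! ### Hit counts and their leading terms -/

lemma hit_mono (h : 𝒜 ⊆ ℬ) : hit X 𝒜 ≤ hit X ℬ := card_le_card (filter_subset_filter _ h)

lemma mem_of_hit_le (h : ∀ F ∈ 𝒜, (F ∩ X).Nonempty → F ∈ ℬ) (hle : hit X ℬ ≤ hit X 𝒜)
    (hF : F ∈ ℬ) (hFX : (F ∩ X).Nonempty) : F ∈ 𝒜 := by
  have hsub : {A ∈ 𝒜 | (A ∩ X).Nonempty} ⊆ {A ∈ ℬ | (A ∩ X).Nonempty} := by
    intro G hG
    rw [mem_filter] at hG ⊢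
    exact ⟨h G hG.1 hG.2, hG.2⟩
  have := eq_of_subset_of_card_le hsub hle
  have hF' : F ∈ {A ∈ ℬ | (A ∩ X).Nonempty} := mem_filter.2 ⟨hF, hFX⟩
  rw [← this] at hF'
  exact (mem_filter.1 hF').1

lemma IsOptimalMLCIF.isOptimalLCIF (h : IsOptimalMLCIF n r X 𝒜) : IsOptimalLCIF n r X 𝒜 := by
  refine ⟨h.1.prop, fun ℱ hℱ => ?_⟩
  obtain ⟨ℬ, hℬ, hsub⟩ := hℱ.exists_isMLCIF
  exact (hit_mono hsub).trans (h.2 ℬ hℬ)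

lemma card_layer_filter_subset {T : Finset ℕ} (hT : T ⊆ Icc 1 n) (hTr : #T ≤ r) :
    #{F ∈ layer n r | T ⊆ F} = (n - #T).choose (r - #T) := by
  have h1 : #(Icc 1 n \ T) = n - #T := by rw [card_sdiff_of_subset hT]; simp
  rw [← h1, ← card_powersetCard]
  refine card_bij' (fun F _ => F \ T) (fun G _ => G ∪ T) ?_ ?_ ?_ ?_
  · intro F hF
    rw [mem_filter, mem_layer] at hF
    rw [mem_powersetCard, card_sdiff_of_subset hF.2, hF.1.2]
    exact ⟨sdiff_subset_sdiff hF.1.1 Subset.rfl, rfl⟩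
  · intro G hG
    rw [mem_powersetCard, subset_sdiff] at hG
    rw [mem_filter, mem_layer, card_union_of_disjoint hG.1.2, hG.2]
    exact ⟨⟨union_subset hG.1.1 hT, by omega⟩, subset_union_right⟩
  · intro F hF
    exact sdiff_union_of_subset (mem_filter.1 hF).2
  · intro G hG
    rw [mem_powersetCard, subset_sdiff] at hG
    exact union_sdiff_cancel_right hG.1.2

lemma card_biUnion_layer_le {t : ℕ} {𝒯 : Finset (Finset ℕ)} (ht : t ≤ r)
    (h𝒯 : ∀ T ∈ 𝒯, T ⊆ Icc 1 n ∧ #T = t) :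
    #(𝒯.biUnion fun T => {F ∈ layer n r | T ⊆ F}) ≤ #𝒯 * (n - t).choose (r - t) := by
  apply card_biUnion_le_card_mul
  intro T hT
  obtain ⟨h1, rfl⟩ := h𝒯 T hT
  exact (card_layer_filter_subset h1 ht).le

lemma hit_le (hr : 3 ≤ r) (hA : 𝒜 ⊆ layer n r) {𝒬 𝒯 : Finset (Finset ℕ)}
    (h𝒬 : ∀ P ∈ 𝒬, P ⊆ Icc 1 n ∧ #P = 2) (h𝒯 : ∀ T ∈ 𝒯, T ⊆ Icc 1 n ∧ #T = 3)
    (h : ∀ F ∈ 𝒜, (F ∩ X).Nonempty → (∃ P ∈ 𝒬, P ⊆ F) ∨ ∃ T ∈ 𝒯, T ⊆ F) :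
    hit X 𝒜 ≤ #𝒬 * (n - 2).choose (r - 2) + #𝒯 * (n - 3).choose (r - 3) := by
  refine le_trans ?_ (Nat.add_le_add (card_biUnion_layer_le (by omega) h𝒬)
    (card_biUnion_layer_le hr h𝒯))
  refine le_trans (card_le_card ?_) (card_union_le _ _)
  intro F hF
  rw [mem_filter] at hF
  have hl := hA hF.1
  simp only [mem_union, mem_biUnion, mem_filter]
  rcases h F hF.1 hF.2 with ⟨P, hP, hPF⟩ | ⟨T, hT, hTF⟩
  · exact Or.inl ⟨P, hP, hl, hPF⟩
  · exact Or.inr ⟨T, hT, hl, hTF⟩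

/-- The star members with `F ∩ X = {x}` form disjoint classes; each class misses only the sets
containing some `{1,x,y}` with `y` another point of `X`. -/
lemma card_mul_choose_le_hit_star (hr : 3 ≤ r) (hX : X ⊆ Icc 2 n) :
    #X * (n - 2).choose (r - 2) ≤
      hit X (star n r) + #X ^ 2 * (n - 3).choose (r - 3) := by
  have hX' : ∀ x ∈ X, 2 ≤ x ∧ x ≤ n := fun x hx => mem_Icc.1 (hX hx)
  have h1 : ∑ x ∈ X, #{F ∈ star n r | F ∩ X = {x}} ≤ hit X (star n r) := by
    rw [← card_biUnion]
    · apply card_le_card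
      intro F hF
      simp only [mem_biUnion, mem_filter] at hF ⊢
      obtain ⟨x, -, hF, hx⟩ := hF
      exact ⟨hF, by rw [hx]; exact singleton_nonempty x⟩
    · intro x _ y _ hxy
      rw [Function.onFun, disjoint_left]
      intro F hF hF'
      rw [mem_filter] at hF hF'
      exact hxy (singleton_injective (hF.2.symm.trans hF'.2))
  have h2 : ∀ x ∈ X, (n - 2).choose (r - 2) ≤
      #{F ∈ star n r | F ∩ X = {x}} + #X * (n - 3).choose (r - 3) := by
    intro x hx
    have hx2 := hX' x hx
    have hc : #({1, x} : Finset ℕ) = 2 := card_pair (by omega)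
    have hcard := card_layer_filter_subset (n := n) (r := r) (T := {1, x})
      (by rw [insert_subset_iff, singleton_subset_iff, mem_Icc, mem_Icc]; omega) (by omega)
    rw [hc] at hcard
    rw [← hcard]
    have hT : ∀ T ∈ (X.erase x).image (fun y => ({1, x, y} : Finset ℕ)),
        T ⊆ Icc 1 n ∧ #T = 3 := by
      intro T hT
      obtain ⟨y, hy, rfl⟩ := mem_image.1 hT
      rw [mem_erase] at hy
      have hy2 := hX' y hy.2
      constructor
      · simp only [insert_subset_iff, singleton_subset_iff, mem_Icc]; omega
      · rw [card_eq_three]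
        exact ⟨1, x, y, by omega, by omega, hy.1.symm, rfl⟩
    have hle : #((X.erase x).image (fun y => ({1, x, y} : Finset ℕ))) *
        (n - 3).choose (r - 3) ≤ #X * (n - 3).choose (r - 3) :=
      Nat.mul_le_mul_right _ (card_image_le.trans (card_le_card (erase_subset _ _)))
    refine le_trans ?_ (Nat.add_le_add_left ((card_biUnion_layer_le hr hT).trans hle) _)
    refine le_trans (card_le_card ?_) (card_union_le _ _)
    intro F hF
    rw [mem_filter, insert_subset_iff, singleton_subset_iff] at hF
    rw [mem_union]
    by_cases hFX : F ∩ X = {x}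
    · exact Or.inl (mem_filter.2 ⟨mem_star.2 ⟨hF.1, hF.2.1⟩, hFX⟩)
    · right
      obtain ⟨y, hyF, hyX, hyx⟩ : ∃ y ∈ F, y ∈ X ∧ y ≠ x := by
        by_contra! hc
        apply hFX
        ext y
        rw [mem_inter, mem_singleton]
        exact ⟨fun hy => hc y hy.1 hy.2, fun hy => hy ▸ ⟨hF.2.2, hx⟩⟩
      simp only [mem_biUnion, mem_filter, mem_image, mem_erase]
      refine ⟨_, ⟨y, ⟨hyx, hyX⟩, rfl⟩, hF.1, ?_⟩
      simp only [insert_subset_iff, singleton_subset_iff]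
      exact ⟨hF.2.1, hF.2.2, hyF⟩
  calc #X * (n - 2).choose (r - 2) = ∑ x ∈ X, (n - 2).choose (r - 2) := by simp
    _ ≤ ∑ x ∈ X, (#{F ∈ star n r | F ∩ X = {x}} + #X * (n - 3).choose (r - 3)) :=
        sum_le_sum h2
    _ = ∑ x ∈ X, #{F ∈ star n r | F ∩ X = {x}} + #X ^ 2 * (n - 3).choose (r - 3) := by
        rw [sum_add_distrib]; simp; ring
    _ ≤ _ := Nat.add_le_add_right h1 _

lemma mul_choose_lt_choose (hr : 3 ≤ r) {D : ℕ} (hrn : r ≤ n) (hn : D * (r - 2) + 2 < n) :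
    D * (n - 3).choose (r - 3) < (n - 2).choose (r - 2) := by
  have h := Nat.add_one_mul_choose_eq (n - 3) (r - 3)
  rw [show n - 3 + 1 = n - 2 by omega, show r - 3 + 1 = r - 2 by omega] at h
  have hb : 0 < (n - 3).choose (r - 3) := Nat.choose_pos (by omega)
  have hlt : D * (r - 2) * (n - 3).choose (r - 3) < (n - 2) * (n - 3).choose (r - 3) :=
    Nat.mul_lt_mul_of_pos_right (by omega) hb
  rw [h] at hlt
  apply Nat.lt_of_mul_lt_mul_right (a := r - 2)
  calc D * (n - 3).choose (r - 3) * (r - 2) = D * (r - 2) * (n - 3).choose (r - 3) := by ring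
    _ < _ := hlt

/-- The two-element traces on `[k]` of members of `𝒜` that meet `X`. -/
def tracePairs (k : ℕ) (X : Finset ℕ) (𝒜 : Finset (Finset ℕ)) : Finset (Finset ℕ) :=
  {P ∈ 𝒜.image (· ∩ Icc 1 k) | #P = 2 ∧ (P ∩ X).Nonempty}

lemma mem_tracePairs {k : ℕ} {P : Finset ℕ} : P ∈ tracePairs k X 𝒜 ↔
    (∃ F ∈ 𝒜, F ∩ Icc 1 k = P) ∧ #P = 2 ∧ (P ∩ X).Nonempty := by
  simp [tracePairs]

lemma IsLCIF.hit_le_of_not_subset_star (h : IsLCIF n r 𝒜) (hr : 3 ≤ r) (hn : 2 * r ≤ n)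
    (hX : X ⊆ Icc 2 n) (hS : ¬ 𝒜 ⊆ star n r) :
    hit X 𝒜 ≤ #(tracePairs (2 * r) X 𝒜) * (n - 2).choose (r - 2) +
      (2 * r + #X).choose 3 * (n - 3).choose (r - 3) := by
  set U := Icc 1 (2 * r) ∪ X with hU
  have hUn : U ⊆ Icc 1 n :=
    union_subset (Icc_subset_Icc le_rfl hn) (hX.trans (Icc_subset_Icc (by norm_num) le_rfl))
  refine (hit_le (𝒬 := tracePairs (2 * r) X 𝒜) (𝒯 := U.powersetCard 3) hr h.subset_layer
    ?_ ?_ ?_).trans (Nat.add_le_add_left (Nat.mul_le_mul_right _ ?_) _)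
  · intro P hP
    obtain ⟨⟨F, hF, rfl⟩, hc, -⟩ := mem_tracePairs.1 hP
    exact ⟨inter_subset_left.trans (mem_layer.1 (h.subset_layer hF)).1, hc⟩
  · intro T hT
    rw [mem_powersetCard] at hT
    exact ⟨hT.1.trans hUn, hT.2⟩
  · intro F hF hFX
    have h2 := h.two_le_card_trace hS hF
    -- If `F` has only two points in `U`, both are in its trace on `[2r]`, so that pair itself meets
    -- `X`.
    by_cases h3 : 3 ≤ #(F ∩ U)
    · right
      obtain ⟨T, hT, hTc⟩ := exists_subset_card_eq h3
      exact ⟨T, mem_powersetCard.2 ⟨hT.trans inter_subset_right, hTc⟩,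
        hT.trans inter_subset_left⟩
    · left
      have hsub : F ∩ Icc 1 (2 * r) ⊆ F ∩ U := inter_subset_inter_left subset_union_left
      have heq := eq_of_subset_of_card_le hsub (by omega)
      refine ⟨F ∩ Icc 1 (2 * r), mem_tracePairs.2 ⟨⟨F, hF, rfl⟩, ?_, ?_⟩, inter_subset_left⟩
      · have := card_le_card hsub; omega
      · obtain ⟨x, hx⟩ := hFX
        rw [mem_inter] at hx
        refine ⟨x, mem_inter.2 ⟨?_, hx.2⟩⟩
        rw [heq]
        exact mem_inter.2 ⟨hx.1, mem_union_right _ hx.2⟩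
  · rw [card_powersetCard]
    apply Nat.choose_le_choose
    refine (card_union_le _ _).trans ?_
    simp

/-! ### Strict comparisons for large `n` -/

/-- A bound past which the leading terms of the counts decide all comparisons. -/
def threshold (r : ℕ) : ℕ :=
  let K := (2 * r).choose 2 + 1
  ((2 * r + K).choose 3 + K ^ 2) * (r - 2) + 2 * r + 4

lemma IsLCIF.hit_lt_hit_star (h : IsLCIF n r 𝒜) (hr : 3 ≤ r) (hn : threshold r ≤ n)
    (hX : X ⊆ Icc 2 n) (hS : ¬ 𝒜 ⊆ star n r) (hlt : #(tracePairs (2 * r) X 𝒜) < #X) :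
    hit X 𝒜 < hit X (star n r) := by
  unfold threshold at hn
  set K := (2 * r).choose 2 + 1 with hK
  simp only at hn
  -- The two summands of `D` absorb the triples in the upper bound for `𝒜` and the loss in the lower
  -- bound for the star.
  have hab := mul_choose_lt_choose (r := r) (n := n) hr
    (D := (2 * r + K).choose 3 + K ^ 2) (by omega) (by omega)
  by_cases hXK : #X ≤ K
  · have h1 := h.hit_le_of_not_subset_star hr (by omega) hX hS
    have h2 := card_mul_choose_le_hit_star hr hX
    set a := (n - 2).choose (r - 2)
    set b := (n - 3).choose (r - 3)
    have h3 : (2 * r + #X).choose 3 ≤ (2 * r + K).choose 3 :=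
      Nat.choose_le_choose _ (by omega)
    have h4 : #X ^ 2 ≤ K ^ 2 := Nat.pow_le_pow_left hXK 2
    have h5 : (#(tracePairs (2 * r) X 𝒜) + 1) * a ≤ #X * a := Nat.mul_le_mul_right _ hlt
    have h6 := Nat.mul_le_mul_right b h3
    have h7 := Nat.mul_le_mul_right b h4
    rw [add_mul] at hab h5
    omega
  -- Only `K - 1` pairs exist in `[2r]`, and every member contains one, so `K` points of `X` already
  -- suffice for the star to win.
  · obtain ⟨Y, hYX, hY⟩ := exists_subset_card_eq (show K ≤ #X by omega)
    have h1 : hit X (star n r) ≥ hit Y (star n r) := by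
      apply card_le_card
      intro F hF
      rw [mem_filter] at hF ⊢
      exact ⟨hF.1, hF.2.mono (inter_subset_inter_left hYX)⟩
    have h2 := card_mul_choose_le_hit_star hr (hYX.trans hX)
    rw [hY] at h2
    have h3 := hit_le (X := X) (𝒬 := (Icc 1 (2 * r)).powersetCard 2) (𝒯 := ∅) hr h.subset_layer
      (by
        intro P hP
        rw [mem_powersetCard] at hP
        exact ⟨hP.1.trans (Icc_subset_Icc le_rfl (by omega)), hP.2⟩) (by simp)
      (by
        intro F hF _
        left
        obtain ⟨P, hP, hPc⟩ := exists_subset_card_eq (h.two_le_card_trace hS hF)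
        exact ⟨P, mem_powersetCard.2 ⟨hP.trans inter_subset_right, hPc⟩,
          hP.trans inter_subset_left⟩)
    simp only [card_powersetCard, Nat.card_Icc, card_empty, zero_mul, add_zero,
      Nat.add_sub_cancel] at h3
    rw [hK, add_mul, one_mul, ← hK] at h2
    rw [add_mul] at hab
    set a := (n - 2).choose (r - 2)
    set b := (n - 3).choose (r - 3)
    omega

lemma hit_star_lt_hit_AHM {m : ℕ} (hm : 3 ≤ m) (hmr : m ≤ r + 1) (hn : 2 * r + 1 ≤ n)
    (hX : X ⊆ Icc 2 m) (hmX : m ∈ X) : hit X (star n r) < hit X (AHM n r m) := by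
  apply card_lt_card
  rw [ssubset_iff_of_subset]
  · obtain ⟨W, hW, hsub, hW1⟩ := exists_mem_layer (n := n) (r := r) (P := Icc 2 m) (Q := {1})
      (Icc_subset_Icc (by norm_num) (by omega)) (by simp; omega) (by simp) (by simp; omega)
    refine ⟨W, mem_filter.2 ⟨mem_AHM.2 ⟨hW, Or.inr hsub⟩,
      m, mem_inter.2 ⟨hsub (hX hmX), hmX⟩⟩, ?_⟩
    rw [mem_filter, mem_star]
    rintro ⟨⟨-, h1⟩, -⟩
    exact disjoint_left.1 hW1 h1 (mem_singleton_self 1)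
  · intro F hF
    rw [mem_filter, mem_star] at hF
    obtain ⟨x, hx⟩ := hF.2
    rw [mem_inter] at hx
    exact mem_filter.2 ⟨mem_AHM.2 ⟨hF.1.1, Or.inl ⟨hF.1.2, x, hx.1, mem_Icc.1 (hX hx.2)⟩⟩, hF.2⟩

/-- The map `φ` fixes star members meeting `{2,3}` and replaces `{1,x}` by `{2,3}` in the others. It
is injective, and its image omits every set that contains `{2,3,x}` but not 1. -/
lemma hit_star_lt_hit_AHM_three (hr : 3 ≤ r) (hn : 2 * r + 2 ≤ n) {x : ℕ} (hx4 : 4 ≤ x)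
    (hxn : x ≤ n) (hX : X ⊆ {2, 3, x}) (h23 : 2 ∈ X ∨ 3 ∈ X) :
    hit X (star n r) < hit X (AHM n r 3) := by
  set φ : Finset ℕ → Finset ℕ := fun F =>
    if 2 ∈ F ∨ 3 ∈ F then F else insert 2 (insert 3 ((F.erase 1).erase x)) with hφ
  have hIcc : Icc 2 3 = ({2, 3} : Finset ℕ) := by decide
  have hmem : ∀ F ∈ star n r, (F ∩ X).Nonempty → ¬ (2 ∈ F ∨ 3 ∈ F) → x ∈ F := by
    intro F _ hFX h
    obtain ⟨y, hy⟩ := hFX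
    rw [mem_inter] at hy
    have := hX hy.2
    simp only [mem_insert, mem_singleton] at this
    rcases this with rfl | rfl | rfl
    · tauto
    · tauto
    · exact hy.1
  have hmaps : ∀ F ∈ star n r, (F ∩ X).Nonempty →
      φ F ∈ AHM n r 3 ∧ (φ F ∩ X).Nonempty ∧ (1 ∈ φ F ∨ x ∉ φ F) := by
    intro F hF hFX
    have hF' := mem_star.1 hF
    simp only [hφ]
    split_ifs with h
    · refine ⟨mem_AHM.2 ⟨hF'.1, Or.inl ⟨hF'.2, ?_⟩⟩, hFX, Or.inl hF'.2⟩
      rcases h with h | h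
      · exact ⟨2, h, by norm_num⟩
      · exact ⟨3, h, by norm_num⟩
    · have hxF := hmem F hF hFX h
      push Not at h
      have hl1 := shift_mem_layer (j := 3) hF'.1 (mem_Icc.2 ⟨by omega, by omega⟩) hF'.2 h.2
      have hl2 := shift_mem_layer (i := x) (j := 2) hl1 (mem_Icc.2 ⟨by omega, by omega⟩)
        (by simp; right; exact ⟨by omega, hxF⟩) (by simp [h.1])
      rw [erase_insert_of_ne (by omega)] at hl2
      refine ⟨mem_AHM.2 ⟨hl2, Or.inr ?_⟩, ?_, Or.inr ?_⟩
      · rw [hIcc]; simp [insert_subset_iff]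
      · rcases h23 with h | h
        · exact ⟨2, by simp [h]⟩
        · exact ⟨3, by simp [h]⟩
      · simp; omega
  have hinj : Set.InjOn φ ({F ∈ star n r | (F ∩ X).Nonempty} : Finset (Finset ℕ)) := by
    intro F hF G hG hFG
    rw [mem_coe, mem_filter] at hF hG
    have h1F := (mem_star.1 hF.1).2
    have h1G := (mem_star.1 hG.1).2
    simp only [hφ] at hFG
    split_ifs at hFG with h h' h'
    · exact hFG
    · rw [hFG] at h1F; simp at h1F
    · rw [← hFG] at h1G; simp at h1G
    · have hxF := hmem F hF.1 hF.2 h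
      have hxG := hmem G hG.1 hG.2 h'
      ext y
      have := congrArg (y ∈ ·) hFG
      simp only [mem_insert, mem_erase, eq_iff_iff] at this
      push Not at h h'
      by_cases hy1 : y = 1
      · subst hy1; tauto
      by_cases hyx : y = x
      · subst hyx; tauto
      by_cases hy2 : y = 2
      · subst hy2; tauto
      by_cases hy3 : y = 3
      · subst hy3; tauto
      tauto
  have hcard : hit X (star n r) = #({F ∈ star n r | (F ∩ X).Nonempty}.image φ) :=
    (card_image_of_injOn hinj).symm
  rw [hcard]
  apply card_lt_card
  rw [ssubset_iff_of_subset]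
  · obtain ⟨W, hW, hsub, hW1⟩ := exists_mem_layer (n := n) (r := r) (P := {2, 3, x}) (Q := {1})
      (by simp only [insert_subset_iff, singleton_subset_iff, mem_Icc]; omega)
      (card_le_three.trans hr) (by simp; omega) (by simp; omega)
    simp only [insert_subset_iff, singleton_subset_iff] at hsub
    refine ⟨W, mem_filter.2 ⟨mem_AHM.2 ⟨hW, Or.inr ?_⟩, ?_⟩, ?_⟩
    · rw [hIcc]; simp [insert_subset_iff, hsub]
    · rcases h23 with h | h
      · exact ⟨2, by simp [h, hsub]⟩
      · exact ⟨3, by simp [h, hsub]⟩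
    · intro hWim
      obtain ⟨F, hF, rfl⟩ := mem_image.1 hWim
      rw [mem_filter] at hF
      rcases (hmaps F hF.1 hF.2).2.2 with h | h
      · exact disjoint_left.1 hW1 h (mem_singleton_self 1)
      · exact h hsub.2.2
  · intro G hG
    obtain ⟨F, hF, rfl⟩ := mem_image.1 hG
    rw [mem_filter] at hF
    have := hmaps F hF.1 hF.2
    exact mem_filter.2 ⟨this.1, this.2.1⟩

/-! ### Recovering a family from its members that meet `X` -/

/-- If `t ∉ F`, replace some `x ∈ F` in `[2,t)` by `t`: the new set meets `X`, so it is a member,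
and shifting `t` back to `x` returns `F`. -/
lemma IsLCIF.AHM_subset (h : IsLCIF n r 𝒜) {t : ℕ} (ht : 2 ≤ t) (htn : t ≤ n) (htX : t ∈ X)
    (hA : ∀ F ∈ AHM n r t, 1 ∈ F ∨ Icc 2 t ⊆ F → (F ∩ X).Nonempty → F ∈ 𝒜) :
    AHM n r t ⊆ 𝒜 := by
  intro F hF
  have hF' := mem_AHM.1 hF
  by_cases htF : t ∈ F
  · exact hA F hF (hF'.2.imp_left And.left) ⟨t, mem_inter.2 ⟨htF, htX⟩⟩
  rcases hF'.2 with ⟨h1, x, hx, hx2, hxt⟩ | hsub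
  · have hxt' : x < t := lt_of_le_of_ne hxt (by rintro rfl; exact htF hx)
    have hG : insert t (F.erase x) ∈ 𝒜 := by
      have h1' : 1 ∈ insert t (F.erase x) := by simp [h1]; omega
      refine hA _ (mem_AHM.2 ⟨shift_mem_layer hF'.1 (mem_Icc.2 ⟨by omega, htn⟩) hx htF,
        Or.inl ⟨h1', t, mem_insert_self _ _, ht, le_rfl⟩⟩) (Or.inl h1')
        ⟨t, mem_inter.2 ⟨mem_insert_self _ _, htX⟩⟩
    have := h.shift hG (j := x) (by omega) hxt' (mem_insert_self _ _) (by simp; omega)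
    rwa [erase_insert (by simp [htF]), insert_erase hx] at this
  · exact absurd (hsub (mem_Icc.2 ⟨ht, le_rfl⟩)) htF

lemma IsLCIF.AHM_three_subset (h : IsLCIF n r 𝒜) (hn : 3 ≤ n) (h23 : 2 ∈ X ∨ 3 ∈ X)
    (hA : ∀ F ∈ AHM n r 3, (F ∩ X).Nonempty → F ∈ 𝒜) : AHM n r 3 ⊆ 𝒜 := by
  rcases h23 with h2 | h3
  · intro F hF
    have hF' := mem_AHM.1 hF
    by_cases h2F : 2 ∈ F
    · exact hA F hF ⟨2, mem_inter.2 ⟨h2F, h2⟩⟩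
    rcases hF'.2 with ⟨h1, x, hx, hx2, hxt⟩ | hsub
    · obtain rfl : x = 3 := by
        have : x ≠ 2 := by rintro rfl; exact h2F hx
        omega
      -- Here `F` contains 1 and 3 but not 2; trading 1 for 2 gives a set that meets `X`, and the
      -- shift from 2 to 1 undoes the trade.
      have hG : insert 2 (F.erase 1) ∈ 𝒜 := by
        refine hA _ (mem_AHM.2 ⟨shift_mem_layer hF'.1 (mem_Icc.2 ⟨by omega, by omega⟩) h1 h2F,
          Or.inr ?_⟩) ⟨2, mem_inter.2 ⟨mem_insert_self _ _, h2⟩⟩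
        rw [show Icc 2 3 = ({2, 3} : Finset ℕ) by decide]
        simp [insert_subset_iff, hx]
      have := h.shift hG (j := 1) le_rfl (by norm_num) (mem_insert_self _ _) (by simp)
      rwa [erase_insert (by simp [h2F]), insert_erase h1] at this
    · exact absurd (hsub (by simp)) h2F
  · exact h.AHM_subset (by norm_num) hn h3 fun F hF _ => hA F hF

/-! ### The case `X = {2}` -/

lemma two_mul_choose_le_hit_AHM_three (hr : 3 ≤ r) (hn : 3 ≤ n) :
    2 * (n - 2).choose (r - 2) ≤ hit {2} (AHM n r 3) + (n - 3).choose (r - 3) := by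
  have c12 := card_layer_filter_subset (n := n) (r := r) (T := {1, 2})
    (by simp only [insert_subset_iff, singleton_subset_iff, mem_Icc]; omega) (by simp; omega)
  have c23 := card_layer_filter_subset (n := n) (r := r) (T := {2, 3})
    (by simp only [insert_subset_iff, singleton_subset_iff, mem_Icc]; omega) (by simp; omega)
  have c123 := card_layer_filter_subset (n := n) (r := r) (T := {1, 2, 3})
    (by simp only [insert_subset_iff, singleton_subset_iff, mem_Icc]; omega) (by simpa)
  rw [show #({1, 2} : Finset ℕ) = 2 from rfl] at c12
  rw [show #({2, 3} : Finset ℕ) = 2 from rfl] at c23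
  rw [show #({1, 2, 3} : Finset ℕ) = 3 from rfl] at c123
  rw [two_mul, ← c123]
  nth_rw 1 [← c12]
  rw [← c23, ← card_union_add_card_inter]
  refine Nat.add_le_add (card_le_card ?_) (card_le_card ?_)
  · intro F hF
    simp only [mem_union, mem_filter, insert_subset_iff, singleton_subset_iff] at hF
    rw [mem_filter, mem_AHM]
    rcases hF with ⟨hl, h1, h2⟩ | ⟨hl, h2, h3⟩
    · exact ⟨⟨hl, Or.inl ⟨h1, 2, h2, by norm_num⟩⟩, 2, by simpa⟩
    · refine ⟨⟨hl, Or.inr ?_⟩, 2, by simpa⟩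
      rw [show Icc 2 3 = ({2, 3} : Finset ℕ) by decide]
      simp [insert_subset_iff, h2, h3]
  · intro F hF
    simp only [mem_inter, mem_filter, insert_subset_iff, singleton_subset_iff] at hF ⊢
    tauto

/-- Without the trace `{2,3}` the only pair trace through 2 is `{1,2}`, so the leading coefficient
is at most 1, against 2 for `AHM n r 3`. -/
lemma IsLCIF.hit_lt_hit_AHM_three (h : IsLCIF n r 𝒜) (hr : 3 ≤ r) (hn : threshold r ≤ n)
    (hS : ¬ 𝒜 ⊆ star n r) (h23 : ∀ F ∈ 𝒜, F ∩ Icc 1 (2 * r) ≠ {2, 3}) :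
    hit {2} 𝒜 < hit {2} (AHM n r 3) := by
  unfold threshold at hn
  simp only at hn
  set K := (2 * r).choose 2 + 1
  have hab := mul_choose_lt_choose (r := r) (n := n) hr
    (D := (2 * r + K).choose 3 + K ^ 2) (by omega) (by omega)
  have h1 := h.hit_le_of_not_subset_star (X := {2}) hr (by omega) (by simp; omega) hS
  have h2 := two_mul_choose_le_hit_AHM_three (n := n) hr (by omega)
  have h3 : #(tracePairs (2 * r) {2} 𝒜) ≤ 1 := by
    rw [card_le_one_iff_subset_singleton]
    refine ⟨{1, 2}, fun P hP => ?_⟩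
    obtain ⟨⟨F, hF, hFP⟩, hc, y, hy⟩ := mem_tracePairs.1 hP
    rw [mem_inter, mem_singleton] at hy
    obtain ⟨hyP, rfl⟩ := hy
    have h1 : 1 ∈ F := by
      by_contra h1
      obtain ⟨G, hG, hG'⟩ := h.exists_trace_two_three hF h1 (by rw [hFP, hc])
      exact h23 G hG hG'
    have h1P : 1 ∈ P := by
      rw [← hFP]; exact mem_inter.2 ⟨h1, mem_Icc.2 (by omega)⟩
    rw [mem_singleton]
    exact (eq_of_subset_of_card_le (by simp [insert_subset_iff, h1P, hyP]) hc.le).symm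
  have h4 : (2 * r + #({2} : Finset ℕ)).choose 3 ≤ (2 * r + K).choose 3 :=
    Nat.choose_le_choose _ (by simp [K])
  have h5 : 1 ≤ K ^ 2 := Nat.one_le_pow _ _ (by simp [K])
  set a := (n - 2).choose (r - 2)
  set b := (n - 3).choose (r - 3)
  have h6 := Nat.mul_le_mul_right a h3
  have h7 := Nat.mul_le_mul_right b h4
  have h8 := Nat.mul_le_mul_right b h5
  rw [add_mul] at hab
  omega

/-! ### Families with too few pair traces -/

/-- Only `{1,2}`, `{1,3}`, `{2,3}` can occur; three, two or none of them meet `X` as `X` contains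
both, one or neither of 2 and 3. -/
lemma card_tracePairs_lt_of_subset_AHM_three (hX : ∀ x ∈ X, 2 ≤ x) (hne : X.Nonempty) {k : ℕ}
    (hk : 3 ≤ k) (hA : 𝒜 ⊆ AHM n r 3)
    (hns : 2 ∈ X ∨ 3 ∈ X → 2 ≤ #(X \ {2, 3})) : #(tracePairs k X 𝒜) < #X := by
  have hsub : ∀ P ∈ tracePairs k X 𝒜, P = {1, 2} ∨ P = {1, 3} ∨ P = {2, 3} := by
    intro P hP
    obtain ⟨⟨F, hF, hFP⟩, hc, -⟩ := mem_tracePairs.1 hP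
    have hmem : ∀ y ∈ F, 1 ≤ y → y ≤ 3 → y ∈ P := fun y hy h1 h3 => by
      rw [← hFP]; exact mem_inter.2 ⟨hy, mem_Icc.2 ⟨h1, h3.trans hk⟩⟩
    have heq : ∀ y z, y ≠ z → y ∈ P → z ∈ P → P = {y, z} := fun y z hyz hy hz =>
      (eq_of_subset_of_card_le (by simp [insert_subset_iff, hy, hz])
        (by rw [hc, card_pair hyz])).symm
    rcases (mem_AHM.1 (hA hF)).2 with ⟨h1, x, hx, hx2, hx3⟩ | h23
    · have h1P := hmem 1 h1 le_rfl (by norm_num)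
      have hxP := hmem x hx (by omega) hx3
      rcases (show x = 2 ∨ x = 3 by omega) with rfl | rfl
      · exact Or.inl (heq 1 2 (by norm_num) h1P hxP)
      · exact Or.inr (Or.inl (heq 1 3 (by norm_num) h1P hxP))
    · exact Or.inr (Or.inr (heq 2 3 (by norm_num)
        (hmem 2 (h23 (by simp)) (by norm_num) (by norm_num))
        (hmem 3 (h23 (by simp)) (by norm_num) (by norm_num))))
  have h1X : 1 ∉ X := fun h => by have := hX 1 h; omega
  have hinter : ∀ P ∈ tracePairs k X 𝒜, (P ∩ X).Nonempty := fun P hP => (mem_tracePairs.1 hP).2.2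
  have hcard := card_sdiff_add_card_inter X {2, 3}
  by_cases h2 : 2 ∈ X <;> by_cases h3 : 3 ∈ X
  · have hle : #(tracePairs k X 𝒜) ≤ #({{1, 2}, {1, 3}, {2, 3}} : Finset (Finset ℕ)) :=
      card_le_card fun P hP => by simpa using hsub P hP
    have h := hns (Or.inl h2)
    have : X ∩ {2, 3} = {2, 3} := inter_eq_right.2 (by simp [insert_subset_iff, h2, h3])
    rw [this, card_pair (by norm_num)] at hcard
    have := hle.trans card_le_three
    omega
  · have hle : #(tracePairs k X 𝒜) ≤ #({{1, 2}, {2, 3}} : Finset (Finset ℕ)) := by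
      refine card_le_card fun P hP => ?_
      have hi := hinter P hP
      rcases hsub P hP with rfl | rfl | rfl
      · simp
      · simp [insert_inter_of_notMem, h1X, h3] at hi
      · simp
    have h := hns (Or.inl h2)
    have : 0 < #(X ∩ {2, 3}) := card_pos.2 ⟨2, by simp [h2]⟩
    have := hle.trans card_le_two
    omega
  · have hle : #(tracePairs k X 𝒜) ≤ #({{1, 3}, {2, 3}} : Finset (Finset ℕ)) := by
      refine card_le_card fun P hP => ?_
      have hi := hinter P hP
      rcases hsub P hP with rfl | rfl | rfl
      · simp [insert_inter_of_notMem, h1X, h2] at hi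
      · simp
      · simp
    have h := hns (Or.inr h3)
    have : 0 < #(X ∩ {2, 3}) := card_pos.2 ⟨3, by simp [h3]⟩
    have := hle.trans card_le_two
    omega
  · have : tracePairs k X 𝒜 = ∅ := by
      refine eq_empty_of_forall_notMem fun P hP => ?_
      have hi := hinter P hP
      rcases hsub P hP with rfl | rfl | rfl <;>
        simp [insert_inter_of_notMem, h1X, h2, h3] at hi
    rw [this, card_empty]
    exact card_pos.2 hne

/-- Every counted trace is `{1,x}` with `x ∈ X`, and `x = m` is excluded. -/
lemma IsLCIF.card_tracePairs_lt (h : IsLCIF n r 𝒜) (hX : ∀ x ∈ X, 2 ≤ x) {k m : ℕ}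
    (hk : 1 ≤ k) (hm : m ∈ X) (h23 : ∀ F ∈ 𝒜, F ∩ Icc 1 k ≠ {2, 3})
    (h1m : ∀ F ∈ 𝒜, F ∩ Icc 1 k ≠ {1, m}) : #(tracePairs k X 𝒜) < #X := by
  have hsub : tracePairs k X 𝒜 ⊆ (X.erase m).image (fun x => ({1, x} : Finset ℕ)) := by
    intro P hP
    obtain ⟨⟨F, hF, hFP⟩, hc, y, hy⟩ := mem_tracePairs.1 hP
    rw [mem_inter] at hy
    have h1 : 1 ∈ F := by
      by_contra h1
      obtain ⟨G, hG, hG'⟩ := h.exists_trace_two_three hF h1 (by rw [hFP, hc])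
      exact h23 G hG hG'
    have h1P : 1 ∈ P := by
      rw [← hFP]; exact mem_inter.2 ⟨h1, mem_Icc.2 ⟨le_rfl, hk⟩⟩
    have hy2 := hX y hy.2
    have heq : ({1, y} : Finset ℕ) = P :=
      eq_of_subset_of_card_le (by simp [insert_subset_iff, h1P, hy.1])
        (by rw [hc, card_pair (by omega)])
    refine mem_image.2 ⟨y, mem_erase.2 ⟨?_, hy.2⟩, heq⟩
    rintro rfl
    exact h1m F hF (hFP.trans heq.symm)
  exact (card_le_card hsub).trans_lt (card_image_le.trans_lt (card_erase_lt_of_mem hm))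

lemma exists_subset_insert_of_card_sdiff_le_one (hX : X ⊆ Icc 2 n) (hn : 4 ≤ n)
    (hc : #(X \ {2, 3}) ≤ 1) : ∃ x, 4 ≤ x ∧ x ≤ n ∧ X ⊆ {2, 3, x} := by
  rcases (X \ {2, 3}).eq_empty_or_nonempty with he | ⟨x, hx⟩
  · rw [sdiff_eq_empty_iff_subset] at he
    refine ⟨4, le_rfl, hn, fun y hy => ?_⟩
    have := he hy
    simp at this ⊢; omega
  · have hx' := mem_Icc.1 (hX (mem_sdiff.1 hx).1)
    have hx3 := (mem_sdiff.1 hx).2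
    simp only [mem_insert, mem_singleton] at hx3
    refine ⟨x, by omega, hx'.2, fun y hy => ?_⟩
    by_cases hy' : y ∈ ({2, 3} : Finset ℕ)
    · simp at hy' ⊢; omega
    · have := card_le_one.1 hc y (mem_sdiff.2 ⟨hy, hy'⟩) x hx
      simp [this]

/-! ### Optimal families outside the star -/

/-- An optimal LCIF outside the star is one of the maximal families `AHM n r t`, and it beats the
star strictly. -/
lemma IsOptimalLCIF.isMLCIF_of_not_subset_star (h : IsOptimalLCIF n r X 𝒜) (hr : 3 ≤ r)
    (hn : threshold r ≤ n) (hX : X ⊆ Icc 2 n) (hne : X.Nonempty) (hS : ¬ 𝒜 ⊆ star n r) :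
    IsMLCIF n r 𝒜 ∧ hit X (star n r) < hit X 𝒜 := by
  have hnr : 2 * r + 4 ≤ n := by unfold threshold at hn; simp only at hn; omega
  have hX2 : ∀ x ∈ X, 2 ≤ x := fun x hx => (mem_Icc.1 (hX hx)).1
  have hstar := h.2 _ isLCIF_star
  have hbig := fun hlt => (h.1.hit_lt_hit_star hr hn hX hS hlt).not_ge hstar
  by_cases h23 : ∃ F ∈ 𝒜, F ∩ Icc 1 (2 * r) = {2, 3}
  · obtain ⟨F, hF, hFP⟩ := h23
    have hsub := h.1.subset_AHM_three hF hFP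
    by_cases hsp : (2 ∈ X ∨ 3 ∈ X) ∧ #(X \ {2, 3}) ≤ 1
    · obtain ⟨x, hx4, hxn, hXx⟩ :=
        exists_subset_insert_of_card_sdiff_le_one hX (by omega) hsp.2
      have hlt := hit_star_lt_hit_AHM_three hr (by omega) hx4 hxn hXx hsp.1
      have hle := h.2 _ (isLCIF_AHM le_rfl)
      have heq : 𝒜 = AHM n r 3 := hsub.antisymm <|
        h.1.AHM_three_subset (by omega) hsp.1 fun F hF hFX =>
          mem_of_hit_le (fun G hG _ => hsub hG) hle hF hFX
      rw [heq]
      exact ⟨isMLCIF_AHM le_rfl (by omega) (by omega), hlt⟩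
    · exact absurd (card_tracePairs_lt_of_subset_AHM_three hX2 hne (by omega) hsub
        fun hh => by by_contra hc; exact hsp ⟨hh, by omega⟩) hbig
  push Not at h23
  set m := X.max' hne with hm
  have hmX : m ∈ X := X.max'_mem hne
  have hXm : X ⊆ Icc 2 m := fun x hx => mem_Icc.2 ⟨hX2 x hx, X.le_max' x hx⟩
  by_cases h1m : ∃ F ∈ 𝒜, F ∩ Icc 1 (2 * r) = {1, m}
  · obtain ⟨F, hF, hFP⟩ := h1m
    -- `AHM n r m` is a usable competitor only for `m ≥ 3`, so `m = 2` is compared with `AHM n r 3`.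
    rcases (hX2 m hmX).eq_or_lt with hm2 | hm3
    · have hXeq : X = {2} := by
        refine (eq_singleton_iff_nonempty_unique_mem.2 ⟨hne, fun x hx => ?_⟩)
        have := mem_Icc.1 (hXm hx)
        omega
      rw [hXeq] at h
      exact absurd (h.2 _ (isLCIF_AHM le_rfl)) (h.1.hit_lt_hit_AHM_three hr hn hS h23).not_ge
    · have hmr : m ≤ r + 1 := by
        obtain ⟨G, hG, hGS⟩ := not_subset.1 hS
        have hGl := h.1.subset_layer hG
        have hsub := h.1.Icc_subset hF hFP hG fun h1 => hGS (mem_star.2 ⟨hGl, h1⟩)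
        have := card_le_card hsub
        rw [(mem_layer.1 hGl).2, Nat.card_Icc] at this
        omega
      have hlt := hit_star_lt_hit_AHM (n := n) hm3 hmr (by omega) hXm hmX
      have hle := h.2 _ (isLCIF_AHM hm3)
      have hcontains : ∀ G ∈ 𝒜, (G ∩ X).Nonempty → G ∈ AHM n r m := by
        intro G hG ⟨x, hx⟩
        rw [mem_inter] at hx
        refine mem_AHM.2 ⟨h.1.subset_layer hG, ?_⟩
        by_cases h1 : 1 ∈ G
        · exact Or.inl ⟨h1, x, hx.1, mem_Icc.1 (hXm hx.2)⟩
        · exact Or.inr (h.1.Icc_subset hF hFP hG h1)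
      have hAHM : AHM n r m ⊆ 𝒜 := h.1.AHM_subset (by omega) (by omega) hmX
        fun G hG _ hGX => mem_of_hit_le hcontains hle hG hGX
      have heq : 𝒜 = AHM n r m :=
        (subset_AHM_of_intersecting hmr (by omega) (by omega) h.1 hAHM).antisymm hAHM
      rw [heq]
      exact ⟨isMLCIF_AHM hm3 hmr (by omega), hlt⟩
  · push Not at h1m
    exact absurd (h.1.card_tracePairs_lt hX2 (by omega) hmX h23 h1m) hbig

end LCIF

/-! ### The corollary -/

theorem corollary3p3 (r : ℕ) (hr : 3 ≤ r) :
    ∃ N : ℕ, ∀ n : ℕ, N ≤ n → ∀ (X : Finset ℕ) (hX : X.Nonempty), X ⊆ Finset.Icc 2 n →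
      (¬ LCIF.IsOptimalMLCIF n r X (LCIF.star n r) →
        ∀ 𝒜 : Finset (Finset ℕ),
          LCIF.IsOptimalLCIF n r X 𝒜 ↔ LCIF.IsOptimalMLCIF n r X 𝒜) ∧
      (LCIF.IsOptimalMLCIF n r X (LCIF.star n r) →
        ∀ 𝒜 : Finset (Finset ℕ),
          LCIF.IsOptimalLCIF n r X 𝒜 ↔
            LCIF.IsLCIF n r 𝒜 ∧ LCIF.AHM n r (X.max' hX) ⊆ 𝒜 ∧ 𝒜 ⊆ LCIF.star n r) := by
  refine ⟨LCIF.threshold r, fun n hn X hne hX => ?_⟩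
  have hnr : 2 * r + 4 ≤ n := by unfold LCIF.threshold at hn; simp only at hn; omega
  constructor
  · intro hS 𝒜
    refine ⟨fun h => ?_, LCIF.IsOptimalMLCIF.isOptimalLCIF⟩
    by_cases hAS : 𝒜 ⊆ LCIF.star n r
    · exact absurd ⟨LCIF.isMLCIF_star (by omega) (by omega),
        fun ℱ hℱ => (h.2 ℱ hℱ.prop).trans (LCIF.hit_mono hAS)⟩ hS
    · exact ⟨(h.isMLCIF_of_not_subset_star hr hn hX hne hAS).1, fun ℱ hℱ => h.2 ℱ hℱ.prop⟩
  · intro hS 𝒜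
    have hS' := hS.isOptimalLCIF
    set m := X.max' hne with hm
    have hmX : m ∈ X := X.max'_mem hne
    have hm2 := Finset.mem_Icc.1 (hX hmX)
    have hXm : X ⊆ Icc 2 m := fun x hx =>
      mem_Icc.2 ⟨(mem_Icc.1 (hX hx)).1, X.le_max' x hx⟩
    constructor
    · intro h
      have hAS : 𝒜 ⊆ LCIF.star n r := by
        by_contra hAS
        exact (h.isMLCIF_of_not_subset_star hr hn hX hne hAS).2.not_ge (hS'.2 𝒜 h.1)
      -- Otherwise `AHM n r m`, or `AHM n r 3` when `m = 2`, would beat the star. Now no `r`-set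
      -- contains `[2,m]`, so `AHM n r m` lies inside the star.
      have hmr : r + 1 < m := by
        by_contra hmr
        rcases hm2.1.eq_or_lt with hm2' | hm3
        · have hX2 : X ⊆ {2, 3, 4} := fun x hx => by
            have := mem_Icc.1 (hXm hx)
            simp; omega
          exact (LCIF.hit_star_lt_hit_AHM_three hr (by omega) le_rfl (by omega) hX2
            (Or.inl (hm2' ▸ hmX))).not_ge (hS'.2 _ (LCIF.isLCIF_AHM le_rfl))
        · exact (LCIF.hit_star_lt_hit_AHM hm3 (by omega) (by omega) hXm hmX).not_ge
            (hS'.2 _ (LCIF.isLCIF_AHM hm3))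
      refine ⟨h.1, h.1.AHM_subset hm2.1 hm2.2 hmX fun F hF hF1 hFX => ?_, hAS⟩
      have hFl := (LCIF.mem_AHM.1 hF).1
      refine LCIF.mem_of_hit_le (fun G hG _ => hAS hG) (h.2 _ LCIF.isLCIF_star)
        (LCIF.mem_star.2 ⟨hFl, hF1.resolve_right fun hsub => ?_⟩) hFX
      have := card_le_card hsub
      rw [(LCIF.mem_layer.1 hFl).2, Nat.card_Icc] at this
      omega
    · rintro ⟨hA, hAHM, -⟩
      refine ⟨hA, fun ℱ hℱ => (hS'.2 ℱ hℱ).trans (card_le_card fun F hF => ?_)⟩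
      rw [mem_filter, LCIF.mem_star] at hF
      obtain ⟨x, hx⟩ := hF.2
      rw [mem_inter] at hx
      exact mem_filter.2 ⟨hAHM (LCIF.mem_AHM.2
        ⟨hF.1.1, Or.inl ⟨hF.1.2, x, hx.1, mem_Icc.1 (hXm hx.2)⟩⟩), hF.2⟩
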